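/- Let $M$ be a smooth manifold of dimension $n\ge 1$ with a Galilean structure $(\tau,\gamma)$: $\tau\in\Omega^1(M)$ is nowhere vanishing, and $\gamma\in\Gamma(\odot^2TM)$ is positive-semidefinite of corank one with $\iota_\tau\gamma=0$. Assume that it is integrable, i.e. $\tau\wedge \mathrm d\tau=0$, and let $\alpha\in\Omega^1(M)$ be any one-form with $\mathrm d\tau=\tau\wedge\alpha$. Let $(H,s_1,\dots,s_{n-1})$ be the standard basis of $\mathbb R^n$ and $\eta$ the covector dual to $H$, and let $\mathsf G_{\mathtt G}\subset \mathsf{GL}(n,\mathbb R)$ be the group of matrices $\begin{pmatrix}1&0\\ v&\mathsf A\end{pmatrix}$ with $v\in\mathbb R^{n-1}$ and $\mathsf A\in\mathsf O(n-1)$, i.e. the subgroup preserving $\eta$ and $\sum_a s_a\odot s_a$, with Lie algebra $\mathfrak g_{\mathtt G}$. Let $\pi\colon P\to M$ be the $\mathsf G_{\mathtt G}$-structure (a reduction of the frame bundle of $M$ to $\mathsf G_{\mathtt G}$) that determines $(\tau,\gamma)$: every frame $u\in P$, viewed as a linear isomorphism $u\colon\mathbb R^n\to T_{\pi(u)}M$,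 satisfies $\tau_{\pi(u)}\circ u=\eta$ and $\gamma_{\pi(u)}=\sum_a u(s_a)\odot u(s_a)$. Let $\omega\in\Omega^1(P,\mathfrak g_{\mathtt G})$ be an Ehresmann (principal) connection on $P$, let $\vartheta\in\Omega^1(P,\mathbb R^n)$, $\vartheta_u(X)=u^{-1}(\pi_*X)$, be the soldering form, and let $\Theta=\mathrm d\vartheta+\omega\wedge\vartheta\in\Omega^2(P,\mathbb R^n)$ be the intrinsic torsion of $\omega$. Then for every $u\in P$, with $x=\pi(u)$, $$\pi^*(\tau\wedge\alpha)_u=\langle u(\Theta_u),\tau_x\rangle_{T_xM}$$ as alternating two-forms on $T_uP$; the right-hand side is the natural pairing of the $T_xM$-component of $u(\Theta_u)\in\wedge^2T_u^*P\otimes T_xM$ with $\tau_x\in T_x^*M$. -/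

import Mathlib

open scoped Manifold ContDiff

noncomputable section

namespace Galilei

/-! ### Differential forms on a manifold without boundary -/

section Forms

variable {E : Type*} [NormedAddCommGroup E] [NormedSpace ℝ E]
  {F : Type*} [NormedAddCommGroup F] [NormedSpace ℝ F]
  {F' : Type*} [NormedAddCommGroup F'] [NormedSpace ℝ F']
  {F'' : Type*} [NormedAddCommGroup F''] [NormedSpace ℝ F'']
  {E' : Type*} [NormedAddCommGroup E'] [NormedSpace ℝ E']

/-- A (not necessarily smooth) differential `k`-form on the manifold `M`, modelled on `E`,
with values in the vector space `F`. -/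
abbrev DiffForm (E : Type*) [NormedAddCommGroup E] [NormedSpace ℝ E]
    (M : Type*) [TopologicalSpace M] [ChartedSpace E M]
    (F : Type*) [NormedAddCommGroup F] [NormedSpace ℝ F] (k : ℕ) : Type _ :=
  ∀ x : M, TangentSpace 𝓘(ℝ, E) x [⋀^Fin k]→L[ℝ] F

variable {M : Type*} [TopologicalSpace M] [ChartedSpace E M]
  {N : Type*} [TopologicalSpace N] [ChartedSpace E' N]

/-- The expression of a `k`-form in the preferred chart `φ` at `x₀`, i.e. its pullback under
`φ⁻¹`, as a form on (the target of `φ` in) the model space `E`. -/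
def DiffForm.inChart {k : ℕ} (θ : DiffForm E M F k) (x₀ : M) (e : E) : E [⋀^Fin k]→L[ℝ] F :=
  (θ ((extChartAt 𝓘(ℝ, E) x₀).symm e)).compContinuousLinearMap
    (mfderiv 𝓘(ℝ, E) 𝓘(ℝ, E) (extChartAt 𝓘(ℝ, E) x₀).symm e)

/-- A form is smooth if its expressions in charts covering `M` are smooth. -/
def DiffForm.IsSmooth {k : ℕ} (θ : DiffForm E M F k) : Prop :=
  ∀ x₀ : M, ContDiffOn ℝ ∞ (θ.inChart x₀) (extChartAt 𝓘(ℝ, E) x₀).target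

/-- The exterior derivative, computed at `x` in the preferred chart at `x`. The normalisation is
`dθ(X, Y) = X(θ(Y)) - Y(θ(X)) - θ([X, Y])` for one-forms. -/
def DiffForm.d {k : ℕ} (θ : DiffForm E M F k) : DiffForm E M F (k + 1) := fun x =>
  (extDeriv (θ.inChart x) (extChartAt 𝓘(ℝ, E) x x)).compContinuousLinearMap
    (mfderiv 𝓘(ℝ, E) 𝓘(ℝ, E) (extChartAt 𝓘(ℝ, E) x) x)

/-- The pullback of a form under a map. -/
def DiffForm.pullback {k : ℕ} (θ : DiffForm E M F k) (f : N → M) : DiffForm E' N F k := fun y =>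
  (θ (f y)).compContinuousLinearMap (mfderiv 𝓘(ℝ, E') 𝓘(ℝ, E) f y)

/-- A family of linear maps `T_x M → F`, regarded as a one-form. -/
def DiffForm.ofLinear (a : ∀ x : M, TangentSpace 𝓘(ℝ, E) x →L[ℝ] F) : DiffForm E M F 1 := fun x =>
  ContinuousAlternatingMap.ofSubsingleton ℝ (TangentSpace 𝓘(ℝ, E) x) F (0 : Fin 1) (a x)

/-- The linear map `T_x M → F` underlying a one-form at the point `x`. -/
def DiffForm.linearAt (a : DiffForm E M F 1) (x : M) : TangentSpace 𝓘(ℝ, E) x →L[ℝ] F :=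
  (ContinuousAlternatingMap.ofSubsingleton ℝ (TangentSpace 𝓘(ℝ, E) x) F (0 : Fin 1)).symm (a x)

/-- The wedge product of a linear form and an alternating `k`-form on a vector space, with values
multiplied by the bilinear map `B`:
`(a ∧ b)(v₀, …, v_k) = ∑ i, (-1)^i B (a(v_i)) (b(v₀, …, v̂_i, …, v_k))`. -/
def linearWedge (B : F →L[ℝ] F' →L[ℝ] F'') {k : ℕ} (a : E →L[ℝ] F) (b : E [⋀^Fin k]→L[ℝ] F') :
    E [⋀^Fin (k + 1)]→L[ℝ] F'' :=
  ContinuousAlternatingMap.alternatizeUncurryFin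
    (((ContinuousLinearMap.compContinuousAlternatingMapCLM ℝ E F' F'' (Fin k)).flip b) ∘L B ∘L a)

/-- The wedge product `a ∧ b` of a one-form `a` and a `k`-form `b`, with values multiplied by the
bilinear map `B`. For two one-forms, `(a ∧ b)(X, Y) = B (a X) (b Y) - B (a Y) (b X)`. -/
def DiffForm.wedge (B : F →L[ℝ] F' →L[ℝ] F'') {k : ℕ} (a : DiffForm E M F 1)
    (b : DiffForm E M F' k) : DiffForm E M F'' (k + 1) := fun x =>
  (linearWedge (E := E) B (a.linearAt x) (b x) : E [⋀^Fin (k + 1)]→L[ℝ] F'')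

end Forms

/-! ### The Galilean group and its Lie algebra -/

section Group

/-- The model space `ℝⁿ` with `n = d + 1`; its standard basis is `(H, s₁, …, s_d)`. -/
abbrev Model (d : ℕ) : Type := EuclideanSpace ℝ (Fin (d + 1))

/-- The spatial basis vector `s_a` of `ℝ^(d+1)`. -/
def spatial {d : ℕ} (a : Fin d) : Model d := EuclideanSpace.single a.succ 1

/-- The Galilean group: the subgroup of `GL(d + 1, ℝ)` preserving the covector `η` dual to `H`
(`η v = v 0`) and the symmetric tensor `∑ a, s_a ⊙ s_a`. -/
def galileanGroup (d : ℕ) : Subgroup (Model d ≃L[ℝ] Model d) where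
  carrier := {g | (∀ v, g v 0 = v 0) ∧ ∀ ξ ζ : Model d →L[ℝ] ℝ,
    ∑ a : Fin d, ξ (g (spatial a)) * ζ (g (spatial a)) =
      ∑ a : Fin d, ξ (spatial a) * ζ (spatial a)}
  one_mem' := ⟨fun _ => rfl, fun _ _ => rfl⟩
  mul_mem' := by
    rintro g h ⟨hg, hg'⟩ ⟨hh, hh'⟩
    refine ⟨fun v => (hg (h v)).trans (hh v), fun ξ ζ => ?_⟩
    exact (hh' (ξ ∘L (g : Model d →L[ℝ] Model d)) (ζ ∘L (g : Model d →L[ℝ] Model d))).trans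
      (hg' ξ ζ)
  inv_mem' := by
    rintro g ⟨hg, hg'⟩
    refine ⟨fun v => ?_, fun ξ ζ => ?_⟩
    · have h := hg (g.symm v)
      rw [g.apply_symm_apply] at h
      exact h.symm
    · have h := hg' (ξ ∘L (g.symm : Model d →L[ℝ] Model d))
        (ζ ∘L (g.symm : Model d →L[ℝ] Model d))
      simp only [ContinuousLinearMap.comp_apply, ContinuousLinearEquiv.coe_coe,
        ContinuousLinearEquiv.symm_apply_apply] at h
      exact h.symm

/-- The Lie algebra of the Galilean group: the matrices with vanishing first row whose spatial
block is skew-symmetric. -/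
def galileanLieAlgebra (d : ℕ) : Submodule ℝ (Model d →L[ℝ] Model d) where
  carrier := {A | (∀ v, A v 0 = 0) ∧
    ∀ a b : Fin d, A (spatial a) b.succ = - A (spatial b) a.succ}
  zero_mem' := ⟨fun _ => rfl, fun _ _ => by simp⟩
  add_mem' := by
    rintro A B ⟨hA, hA'⟩ ⟨hB, hB'⟩
    refine ⟨fun v => by simp [hA, hB], fun a b => ?_⟩
    simp only [add_apply, PiLp.add_apply, hA' a b, hB' a b]
    ring
  smul_mem' := by
    rintro c A ⟨hA, hA'⟩
    refine ⟨fun v => by simp [hA], fun a b => ?_⟩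
    simp only [smul_apply, PiLp.smul_apply, hA' a b, smul_neg]

/-- The exponential of an endomorphism of `ℝ^(d+1)`, as an invertible map. -/
def expEquiv {d : ℕ} (A : Model d →L[ℝ] Model d) : Model d ≃L[ℝ] Model d :=
  ContinuousLinearEquiv.equivOfInverse (NormedSpace.exp A) (NormedSpace.exp (-A))
    (fun v => by
      let _ : NormedAlgebra ℚ (Model d →L[ℝ] Model d) := NormedAlgebra.restrictScalars ℚ ℝ _
      have h : NormedSpace.exp (-A) * NormedSpace.exp A = 1 := by
        rw [← NormedSpace.exp_add_of_commute (Commute.refl A).neg_left, neg_add_cancel,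
          NormedSpace.exp_zero]
      exact DFunLike.congr_fun h v)
    (fun v => by
      let _ : NormedAlgebra ℚ (Model d →L[ℝ] Model d) := NormedAlgebra.restrictScalars ℚ ℝ _
      have h : NormedSpace.exp A * NormedSpace.exp (-A) = 1 := by
        rw [← NormedSpace.exp_add_of_commute (Commute.refl A).neg_right, add_neg_cancel,
          NormedSpace.exp_zero]
      exact DFunLike.congr_fun h v)

/-- The orthogonal projection `∑ a, s_a ⟨s_a, ·⟩` onto the spatial directions. -/
def spatialProj (d : ℕ) : Model d →L[ℝ] Model d :=
  ∑ a : Fin d, (innerSL ℝ (spatial a)).smulRight (spatial a)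

theorem spatialProj_inner {d : ℕ} (x y : Model d) :
    inner ℝ x (spatialProj d y) = ∑ a : Fin d, inner ℝ x (spatial a) * inner ℝ y (spatial a) := by
  simp only [spatialProj, sum_apply, ContinuousLinearMap.smulRight_apply, innerSL_apply_apply,
    inner_sum, inner_smul_right]
  refine Finset.sum_congr rfl fun a _ => ?_
  rw [real_inner_comm y, mul_comm]

theorem spatialProj_adjoint {d : ℕ} (A : Model d →L[ℝ] Model d) (hA : A ∈ galileanLieAlgebra d) :
    SemiconjBy (spatialProj d) (star A) (-A) := by
  obtain ⟨h0, h1⟩ := hA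
  have key : ∀ x y : Model d, inner ℝ x (A (spatialProj d y)) =
      ∑ a : Fin d, ∑ b : Fin d, x b.succ * y a.succ * A (spatial a) b.succ := by
    intro x y
    have hs : spatialProj d y = ∑ a : Fin d, y a.succ • spatial a := by
      simp [spatialProj, spatial, EuclideanSpace.inner_single_left]
    rw [hs, map_sum, inner_sum]
    refine Finset.sum_congr rfl fun a _ => ?_
    rw [map_smul, inner_smul_right, PiLp.inner_apply, Fin.sum_univ_succ, h0]
    simp [Finset.mul_sum]
    refine Finset.sum_congr rfl fun b _ => ?_
    ring
  have hself : ∀ x y : Model d, inner ℝ x (spatialProj d y) = inner ℝ (spatialProj d x) y := by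
    intro x y
    rw [real_inner_comm y (spatialProj d x), spatialProj_inner, spatialProj_inner]
    exact Finset.sum_congr rfl fun a _ => mul_comm _ _
  refine ContinuousLinearMap.ext fun x => ext_inner_left ℝ fun y => ?_
  change inner ℝ y (spatialProj d ((ContinuousLinearMap.adjoint A) x)) =
    inner ℝ y (-(A (spatialProj d x)))
  rw [hself, ContinuousLinearMap.adjoint_inner_right, real_inner_comm, inner_neg_right, key, key,
    Finset.sum_comm, ← Finset.sum_neg_distrib]
  refine Finset.sum_congr rfl fun a _ => ?_
  rw [← Finset.sum_neg_distrib]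
  refine Finset.sum_congr rfl fun b _ => ?_
  rw [h1 b a]
  ring

theorem expEquiv_mem {d : ℕ} (A : Model d →L[ℝ] Model d) (hA : A ∈ galileanLieAlgebra d) :
    expEquiv A ∈ galileanGroup d := by
  let : NormedAlgebra ℚ (Model d →L[ℝ] Model d) := NormedAlgebra.restrictScalars ℚ ℝ _
  refine ⟨fun v => ?_, fun ξ ζ => ?_⟩
  · let H : Model d →L[ℝ] Model d :=
      (EuclideanSpace.proj (0 : Fin (d + 1)) : Model d →L[ℝ] ℝ).smulRight
        (EuclideanSpace.single 0 1)
    have h : SemiconjBy H A 0 := by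
      refine ContinuousLinearMap.ext fun x => ?_
      change H (A x) = 0
      simp [H, hA.1 x]
    have h2 := DFunLike.congr_fun h.exp_right v
    rw [NormedSpace.exp_zero, one_mul] at h2
    have h3 : (H (NormedSpace.exp A v)) 0 = (H v) 0 := congrArg (fun w : Model d => w 0) h2
    change (NormedSpace.exp A v) 0 = v 0
    simpa [H] using h3
  · have h : SemiconjBy (spatialProj d) (star (NormedSpace.exp A)) (NormedSpace.exp (-A)) := by
      rw [NormedSpace.star_exp]
      exact (spatialProj_adjoint A hA).exp_right
    have h2 : NormedSpace.exp A * (spatialProj d * star (NormedSpace.exp A)) = spatialProj d := by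
      rw [h.eq, ← mul_assoc, ← NormedSpace.exp_add_of_commute (Commute.refl A).neg_right,
        add_neg_cancel, NormedSpace.exp_zero, one_mul]
    obtain ⟨x, rfl⟩ := (InnerProductSpace.toDual ℝ (Model d)).surjective ξ
    obtain ⟨y, rfl⟩ := (InnerProductSpace.toDual ℝ (Model d)).surjective ζ
    simp only [InnerProductSpace.toDual_apply_apply]
    rw [← spatialProj_inner x y, ← h2]
    change _ = inner ℝ x (NormedSpace.exp A
      (spatialProj d ((ContinuousLinearMap.adjoint (NormedSpace.exp A)) y)))
    rw [← ContinuousLinearMap.adjoint_inner_left, spatialProj_inner]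
    refine Finset.sum_congr rfl fun a _ => ?_
    rw [ContinuousLinearMap.adjoint_inner_left, ContinuousLinearMap.adjoint_inner_left]
    rfl

/-- The exponential map of the Galilean group. -/
def galileanExp {d : ℕ} (A : galileanLieAlgebra d) : galileanGroup d :=
  ⟨expEquiv A.1, expEquiv_mem A.1 A.2⟩

end Group

/-! ### Galilean structures -/

section Structures

/-- A Galilean structure on a manifold `M` of dimension `d + 1`: a nowhere-vanishing smooth
one-form `τ` (the clock form), and a smooth symmetric positive-semidefinite bilinear form `γ` of
corank one on the cotangent spaces (the spatial cometric), with `ι_τ γ = 0`. -/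
structure GalileanStructure (d : ℕ) (M : Type*) [TopologicalSpace M] [ChartedSpace (Model d) M]
    [IsManifold 𝓘(ℝ, Model d) ∞ M] where
  /-- the clock form -/
  τ : DiffForm (Model d) M ℝ 1
  τ_smooth : τ.IsSmooth
  τ_ne_zero : ∀ x, τ x ≠ 0
  /-- the spatial cometric -/
  γ : ∀ x : M, (TangentSpace 𝓘(ℝ, Model d) x →L[ℝ] ℝ) →L[ℝ]
    (TangentSpace 𝓘(ℝ, Model d) x →L[ℝ] ℝ) →L[ℝ] ℝ
  /-- the components of `γ` in charts covering `M` are smooth -/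
  γ_smooth : ∀ (x₀ : M) (ξ ζ : Model d →L[ℝ] ℝ), ContDiffOn ℝ ∞
    (fun e => γ ((extChartAt 𝓘(ℝ, Model d) x₀).symm e)
      (ξ ∘L mfderiv 𝓘(ℝ, Model d) 𝓘(ℝ, Model d) (extChartAt 𝓘(ℝ, Model d) x₀)
        ((extChartAt 𝓘(ℝ, Model d) x₀).symm e))
      (ζ ∘L mfderiv 𝓘(ℝ, Model d) 𝓘(ℝ, Model d) (extChartAt 𝓘(ℝ, Model d) x₀)
        ((extChartAt 𝓘(ℝ, Model d) x₀).symm e)))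
    (extChartAt 𝓘(ℝ, Model d) x₀).target
  γ_symm : ∀ x ξ ζ, γ x ξ ζ = γ x ζ ξ
  γ_nonneg : ∀ x ξ, 0 ≤ γ x ξ ξ
  γ_corank : ∀ x, Module.finrank ℝ (LinearMap.ker (γ x).toLinearMap) = 1
  γ_τ : ∀ x, γ x (τ.linearAt x) = 0

variable {d : ℕ} {M : Type*} [TopologicalSpace M] [ChartedSpace (Model d) M]
  [IsManifold 𝓘(ℝ, Model d) ∞ M]

/-- The Galilean structure is integrable if `τ ∧ dτ = 0`. -/
def GalileanStructure.IsIntegrable (𝒢 : GalileanStructure d M) : Prop :=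
  DiffForm.wedge (ContinuousLinearMap.mul ℝ ℝ) 𝒢.τ 𝒢.τ.d = 0

/-! ### `G`-structures -/

/-- The total space of the vector bundle over `M` with fibre `Hom(ℝⁿ, T_x M)` at `x`, where
`n = d + 1`. The frame bundle of `M` is the open subset of all invertible maps. -/
abbrev FrameSpace (d : ℕ) (M : Type*) [TopologicalSpace M] [ChartedSpace (Model d) M]
    [IsManifold 𝓘(ℝ, Model d) ∞ M] : Type _ :=
  Bundle.TotalSpace (Model d →L[ℝ] Model d)
    (fun x : M => Bundle.Trivial M (Model d) x →L[ℝ] TangentSpace 𝓘(ℝ, Model d) x)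

/-- A frame `u : ℝⁿ → T_x M` as a point of the bundle of all linear maps `ℝⁿ → T_x M`. -/
def framePoint (x : M) (u : Model d →L[ℝ] TangentSpace 𝓘(ℝ, Model d) x) : FrameSpace d M :=
  ⟨x, u⟩

/-- A `G`-structure on `M`, for a closed subgroup `G` of `GL(n, ℝ)`: a reduction of the frame bundle
of `M` to `G`. The manifold `P` is embedded in the frame bundle through
`p ↦ (π(p), u_p)`, its image is stable under `G`, the group `G` acts transitively on the fibres,
and `π` has smooth local sections. -/
structure GStructure (G : Subgroup (Model d ≃L[ℝ] Model d)) (EP : Type*) [NormedAddCommGroup EP]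
    [NormedSpace ℝ EP] (P : Type*) [TopologicalSpace P] [ChartedSpace EP P] (M : Type*)
    [TopologicalSpace M] [ChartedSpace (Model d) M] [IsManifold 𝓘(ℝ, Model d) ∞ M] where
  /-- the projection -/
  π : P → M
  /-- the frame `u : ℝⁿ → T_{π(u)} M` that the point `u` of `P` is -/
  frame : ∀ u : P, Model d ≃L[ℝ] TangentSpace 𝓘(ℝ, Model d) (π u)
  isSmoothEmbedding : Manifold.IsSmoothEmbedding 𝓘(ℝ, EP)
    (𝓘(ℝ, Model d).prod 𝓘(ℝ, Model d →L[ℝ] Model d)) ∞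
    (fun u => framePoint (π u) (frame u : Model d →L[ℝ] TangentSpace 𝓘(ℝ, Model d) (π u)))
  exists_section : ∀ x : M, ∃ (U : Set M) (s : M → P), IsOpen U ∧ x ∈ U ∧
    ContMDiffOn 𝓘(ℝ, Model d) 𝓘(ℝ, EP) ∞ s U ∧ ∀ y ∈ U, π (s y) = y
  /-- the right action of `G` on `P`, `R g u = u ∘ g` -/
  R : G → P → P
  frame_R : ∀ (g : G) (u : P),
    framePoint (π (R g u))
      (frame (R g u) : Model d →L[ℝ] TangentSpace 𝓘(ℝ, Model d) (π (R g u))) =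
    framePoint (π u) ((frame u : Model d →L[ℝ] TangentSpace 𝓘(ℝ, Model d) (π u)) ∘L
      (g.1 : Model d →L[ℝ] Model d))
  exists_R_eq : ∀ u v : P, π u = π v → ∃ g : G, R g u = v

variable {EP : Type*} [NormedAddCommGroup EP] [NormedSpace ℝ EP]
  {P : Type*} [TopologicalSpace P] [ChartedSpace EP P]

/-- The Galilean structure `(τ, γ)` is the one determined by the `G`-structure: every frame `u` in
`P` carries `η` to `τ` and `∑ a, s_a ⊙ s_a` to `γ`. -/
def GStructure.Determines (S : GStructure (galileanGroup d) EP P M) (𝒢 : GalileanStructure d M) :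
    Prop :=
  ∀ u : P, (∀ v : Model d, 𝒢.τ.linearAt (S.π u) (S.frame u v) = v 0) ∧
    ∀ ξ ζ : TangentSpace 𝓘(ℝ, Model d) (S.π u) →L[ℝ] ℝ, 𝒢.γ (S.π u) ξ ζ =
      ∑ a : Fin d, ξ (S.frame u (spatial a)) * ζ (S.frame u (spatial a))

/-- The soldering form `ϑ_u(X) = u⁻¹(π_* X)`. -/
def GStructure.soldering {G : Subgroup (Model d ≃L[ℝ] Model d)} (S : GStructure G EP P M) :
    DiffForm EP P (Model d) 1 :=
  DiffForm.ofLinear fun u =>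
    ((S.frame u).symm : TangentSpace 𝓘(ℝ, Model d) (S.π u) →L[ℝ] Model d) ∘L
      mfderiv 𝓘(ℝ, EP) 𝓘(ℝ, Model d) S.π u

/-- The value at `u` of the fundamental vector field on `P` generated by `A`, i.e. the velocity at
`t = 0` of the curve `t ↦ u ∘ exp(t A)`. -/
def GStructure.fundamental (S : GStructure (galileanGroup d) EP P M) (A : galileanLieAlgebra d)
    (u : P) : TangentSpace 𝓘(ℝ, EP) (S.R (galileanExp ((0 : ℝ) • A)) u) :=
  mfderiv 𝓘(ℝ, ℝ) 𝓘(ℝ, EP) (fun t : ℝ => S.R (galileanExp (t • A)) u) 0 (1 : ℝ)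

/-- An Ehresmann (principal) connection on a `G`-structure for the Galilean group `G`: a smooth
one-form `ω` on `P` with values in the Lie algebra of `G`, which reproduces the generators of
fundamental vector fields and satisfies `R_g^* ω = Ad(g⁻¹) ω`. -/
structure EhresmannConnection (S : GStructure (galileanGroup d) EP P M) where
  /-- the connection form -/
  form : DiffForm EP P (Model d →L[ℝ] Model d) 1
  smooth : form.IsSmooth
  mem : ∀ (u : P) (X : TangentSpace 𝓘(ℝ, EP) u), form.linearAt u X ∈ galileanLieAlgebra d
  fundamental : ∀ (A : galileanLieAlgebra d) (u : P),
    form.linearAt (S.R (galileanExp ((0 : ℝ) • A)) u) (S.fundamental A u) = A.1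
  equivariant : ∀ (g : galileanGroup d) (u : P) (X : TangentSpace 𝓘(ℝ, EP) u),
    (form.pullback (S.R g)).linearAt u X =
      (g.1.symm : Model d →L[ℝ] Model d) ∘L form.linearAt u X ∘L (g.1 : Model d →L[ℝ] Model d)

/-- The intrinsic torsion `Θ = dϑ + ω ∧ ϑ` of the connection `ω`, where the Lie algebra acts on
`ℝⁿ` by evaluation. -/
def EhresmannConnection.torsion {S : GStructure (galileanGroup d) EP P M}
    (c : EhresmannConnection S) : DiffForm EP P (Model d) 2 :=
  S.soldering.d + DiffForm.wedge (ContinuousLinearMap.id ℝ (Model d →L[ℝ] Model d)) c.form S.soldering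

/-- For an `ℝⁿ`-valued form `Θ` on `P`, the alternating map `u(Θ_u)` on `T_u P` with values in
`T_{π(u)} M`. -/
def GStructure.applyFrame {G : Subgroup (Model d ≃L[ℝ] Model d)} (S : GStructure G EP P M) {k : ℕ}
    (Θ : DiffForm EP P (Model d) k) (u : P) :
    TangentSpace 𝓘(ℝ, EP) u [⋀^Fin k]→L[ℝ] TangentSpace 𝓘(ℝ, Model d) (S.π u) :=
  (S.frame u : Model d →L[ℝ] TangentSpace 𝓘(ℝ, Model d) (S.π u)).compContinuousAlternatingMap (Θ u)

end Structures

end Galilei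

end

/-! The torsion is tested against the covector `η`. Every frame carries `η` to `τ`, so pairing
`u(Θ_u)` with `τ` gives `η(Θ_u)`. The Galilean Lie algebra annihilates `η`, hence `η(ω ∧ ϑ) = 0` and
only `η(dϑ) = d(η ∘ ϑ)` remains. Again because `τ ∘ u = η`, the form `η ∘ ϑ` is `π^*τ`, whose
differential is `π^*dτ = π^*(τ ∧ α)`.

The work lies in the two commutations of `d`, which is defined pointwise in preferred charts.
`DiffForm.d_pullback` reduces `dπ^* = π^*d` to naturality on vector spaces. `DiffForm.d_compLeft`
moves `η` past `d`; it requires `ϑ` to be differentiable in charts, which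
`contDiffAt_soldering_inChart` extracts from the smoothness of the embedding of `P` into the frame
bundle. -/

noncomputable section

namespace Galilei

open scoped Topology
open Filter

/-! ### Naturality of the exterior derivative in charts -/

section Charts

variable {E : Type*} [NormedAddCommGroup E] [NormedSpace ℝ E]
  {E' : Type*} [NormedAddCommGroup E'] [NormedSpace ℝ E']
  {F : Type*} [NormedAddCommGroup F] [NormedSpace ℝ F]
  {G : Type*} [NormedAddCommGroup G] [NormedSpace ℝ G]
  {M : Type*} [TopologicalSpace M] [ChartedSpace E M]
  {N : Type*} [TopologicalSpace N] [ChartedSpace E' N]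

/-- Points near the base point of a chart stay in the chart domains when mapped by `f`. -/
theorem eventually_mem_charts {f : N → M} {y : N} (hf : ContinuousAt f y) :
    ∀ᶠ e in 𝓝 (extChartAt 𝓘(ℝ, E') y y), e ∈ (extChartAt 𝓘(ℝ, E') y).target ∧
      f ((extChartAt 𝓘(ℝ, E') y).symm e) ∈ (extChartAt 𝓘(ℝ, E) (f y)).source := by
  refine (show ∀ᶠ e in _, _ from extChartAt_target_mem_nhds (I := 𝓘(ℝ, E')) y).and ?_
  have h : ContinuousAt (f ∘ (extChartAt 𝓘(ℝ, E') y).symm) (extChartAt 𝓘(ℝ, E') y y) :=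
    ContinuousAt.comp (by simpa using hf) (continuousAt_extChartAt_symm y)
  refine h.eventually_mem ?_
  simpa using extChartAt_source_mem_nhds (I := 𝓘(ℝ, E)) (f y)

theorem mdifferentiableAt_extChartAt_symm [IsManifold 𝓘(ℝ, E) 1 M] {x : M} {e : E}
    (he : e ∈ (extChartAt 𝓘(ℝ, E) x).target) :
    MDifferentiableAt 𝓘(ℝ, E) 𝓘(ℝ, E) (extChartAt 𝓘(ℝ, E) x).symm e := by
  have h := mdifferentiableWithinAt_extChartAt_symm (I := 𝓘(ℝ, E)) he
  rwa [modelWithCornersSelf_coe, Set.range_id, mdifferentiableWithinAt_univ] at h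

/-- The chain rule for a map written in charts. -/
theorem fderiv_writtenInExtChartAt [IsManifold 𝓘(ℝ, E) 1 M] [IsManifold 𝓘(ℝ, E') 1 N]
    {f : N → M} {y : N} {e : E'}
    (hf : MDifferentiableAt 𝓘(ℝ, E') 𝓘(ℝ, E) f ((extChartAt 𝓘(ℝ, E') y).symm e))
    (he : e ∈ (extChartAt 𝓘(ℝ, E') y).target)
    (hfe : f ((extChartAt 𝓘(ℝ, E') y).symm e) ∈ (extChartAt 𝓘(ℝ, E) (f y)).source) (v : E') :
    fderiv ℝ (writtenInExtChartAt 𝓘(ℝ, E') 𝓘(ℝ, E) y f) e v =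
      mfderiv 𝓘(ℝ, E) 𝓘(ℝ, E) (extChartAt 𝓘(ℝ, E) (f y)) (f ((extChartAt 𝓘(ℝ, E') y).symm e))
        (mfderiv 𝓘(ℝ, E') 𝓘(ℝ, E) f ((extChartAt 𝓘(ℝ, E') y).symm e)
          (mfderiv 𝓘(ℝ, E') 𝓘(ℝ, E') (extChartAt 𝓘(ℝ, E') y).symm e v)) := by
  rw [extChartAt_source] at hfe
  have h1 := mdifferentiableAt_extChartAt_symm (M := N) he
  have h2 := hf.comp e h1
  have h3 := mdifferentiableAt_extChartAt (I := 𝓘(ℝ, E)) hfe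
  rw [← mfderiv_eq_fderiv, writtenInExtChartAt, mfderiv_comp e h3 h2, mfderiv_comp e hf h1]
  rfl

theorem contDiffAt_writtenInExtChartAt {f : N → M} {y : N}
    (hf : ContMDiffAt 𝓘(ℝ, E') 𝓘(ℝ, E) ∞ f y) :
    ContDiffAt ℝ ∞ (writtenInExtChartAt 𝓘(ℝ, E') 𝓘(ℝ, E) y f) (extChartAt 𝓘(ℝ, E') y y) := by
  have h := (contMDiffAt_iff.1 hf).2
  rwa [modelWithCornersSelf_coe, Set.range_id, contDiffWithinAt_univ] at h

/-- In charts, pulling back along `f` is pulling back along its coordinate expression: the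
differentials of the chart at `f y` and of its inverse cancel. The identity holds only near the base
point, which suffices because `extDeriv` depends on the germ. -/
theorem DiffForm.inChart_pullback [IsManifold 𝓘(ℝ, E) 1 M] [IsManifold 𝓘(ℝ, E') 1 N] {k : ℕ}
    (θ : DiffForm E M F k) {f : N → M} (hf : MDifferentiable 𝓘(ℝ, E') 𝓘(ℝ, E) f) (y : N) :
    (θ.pullback f).inChart y =ᶠ[𝓝 (extChartAt 𝓘(ℝ, E') y y)] fun e =>
      (θ.inChart (f y) (writtenInExtChartAt 𝓘(ℝ, E') 𝓘(ℝ, E) y f e)).compContinuousLinearMap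
        (fderiv ℝ (writtenInExtChartAt 𝓘(ℝ, E') 𝓘(ℝ, E) y f) e) := by
  filter_upwards [eventually_mem_charts (E := E) (E' := E') (hf y).continuousAt] with e he
  ext v
  set p := f ((extChartAt 𝓘(ℝ, E') y).symm e) with hp
  have hinv : ∀ w : E, mfderiv 𝓘(ℝ, E) 𝓘(ℝ, E) (extChartAt 𝓘(ℝ, E) (f y)).symm
      (extChartAt 𝓘(ℝ, E) (f y) p) (mfderiv 𝓘(ℝ, E) 𝓘(ℝ, E) (extChartAt 𝓘(ℝ, E) (f y)) p w) = w := by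
    intro w
    have h := mfderivWithin_extChartAt_symm_comp_mfderiv_extChartAt' (I := 𝓘(ℝ, E)) he.2
    rw [modelWithCornersSelf_coe, Set.range_id, mfderivWithin_univ] at h
    exact DFunLike.congr_fun h w
  -- The point `φ⁻¹(φ p)` is only propositionally equal to `p`, so the tangent spaces carrying `θ`
  -- must be identified explicitly.
  have key : ∀ (q : M) (_ : q = p) (v : Fin k → E) (w : Fin k → E), v = w → θ q v = θ p w := by
    rintro q rfl v w rfl; rfl
  symm
  refine key _ ((extChartAt 𝓘(ℝ, E) (f y)).left_inv he.2) _ _ (funext fun i => ?_)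
  change mfderiv 𝓘(ℝ, E) 𝓘(ℝ, E) (extChartAt 𝓘(ℝ, E) (f y)).symm
      (extChartAt 𝓘(ℝ, E) (f y) p) (fderiv ℝ (writtenInExtChartAt 𝓘(ℝ, E') 𝓘(ℝ, E) y f) e (v i)) = _
  rw [fderiv_writtenInExtChartAt (hf _) he.1 he.2]
  exact hinv _

theorem DiffForm.IsSmooth.contDiffAt {k : ℕ} {θ : DiffForm E M F k} (hθ : θ.IsSmooth) (x : M) :
    ContDiffAt ℝ ∞ (θ.inChart x) (extChartAt 𝓘(ℝ, E) x x) :=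
  (hθ x).contDiffAt (extChartAt_target_mem_nhds x)

/-- The exterior derivative commutes with pullbacks. -/
theorem DiffForm.d_pullback [IsManifold 𝓘(ℝ, E) ∞ M] [IsManifold 𝓘(ℝ, E') ∞ N] {k : ℕ}
    {θ : DiffForm E M F k} (hθ : θ.IsSmooth) {f : N → M} (hf : ContMDiff 𝓘(ℝ, E') 𝓘(ℝ, E) ∞ f) :
    (θ.pullback f : DiffForm E' N F k).d = θ.d.pullback f := by
  have : IsManifold 𝓘(ℝ, E) 1 M := .of_le (n := ∞) (by simp)
  have : IsManifold 𝓘(ℝ, E') 1 N := .of_le (n := ∞) (by simp)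
  have hfd : MDifferentiable 𝓘(ℝ, E') 𝓘(ℝ, E) f := hf.mdifferentiable (by simp)
  funext y
  have hF : writtenInExtChartAt 𝓘(ℝ, E') 𝓘(ℝ, E) y f (extChartAt 𝓘(ℝ, E') y y) =
      extChartAt 𝓘(ℝ, E) (f y) (f y) := by simp [writtenInExtChartAt]
  have hd : extDeriv ((θ.pullback f).inChart y) (extChartAt 𝓘(ℝ, E') y y) =
      (extDeriv (θ.inChart (f y)) (extChartAt 𝓘(ℝ, E) (f y) (f y))).compContinuousLinearMap
        (fderiv ℝ (writtenInExtChartAt 𝓘(ℝ, E') 𝓘(ℝ, E) y f) (extChartAt 𝓘(ℝ, E') y y)) := by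
    rw [(θ.inChart_pullback hfd y).extDeriv_eq, ← hF]
    refine extDeriv_pullback (r := ∞) ?_ (contDiffAt_writtenInExtChartAt (hf y)) ?_
    rotate_left
    -- Naturality rests on the symmetry of second derivatives; over `ℝ` two derivatives of the
    -- coordinate map are enough.
    · rw [minSmoothness_of_isRCLikeNormedField]
      exact WithTop.coe_le_coe.2 (le_top : (2 : ℕ∞) ≤ ⊤)
    rw [hF]
    exact (hθ.contDiffAt _).differentiableAt (by simp)
  ext v
  change extDeriv ((θ.pullback f).inChart y) (extChartAt 𝓘(ℝ, E') y y)
    (fun i => mfderiv 𝓘(ℝ, E') 𝓘(ℝ, E') (extChartAt 𝓘(ℝ, E') y) y (v i)) =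
    extDeriv (θ.inChart (f y)) (extChartAt 𝓘(ℝ, E) (f y) (f y)) (fun i =>
      mfderiv 𝓘(ℝ, E) 𝓘(ℝ, E) (extChartAt 𝓘(ℝ, E) (f y)) (f y) (mfderiv 𝓘(ℝ, E') 𝓘(ℝ, E) f y (v i)))
  have hfy : fderiv ℝ (writtenInExtChartAt 𝓘(ℝ, E') 𝓘(ℝ, E) y f) (extChartAt 𝓘(ℝ, E') y y) =
      mfderiv 𝓘(ℝ, E') 𝓘(ℝ, E) f y := by
    rw [(hfd y).mfderiv, modelWithCornersSelf_coe, Set.range_id, fderivWithin_univ]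
  -- At its own base point a preferred chart has the identity as differential, so the chart factors
  -- in `d` disappear.
  rw [hd, hfy, mfderiv_extChartAt_self, mfderiv_extChartAt_self]
  rfl

/-- The exterior derivative commutes with constant linear maps between the spaces of values. -/
theorem DiffForm.d_compLeft {k : ℕ} (L : F →L[ℝ] G) (θ : DiffForm E M F k) (x : M)
    (hθ : DifferentiableAt ℝ (θ.inChart x) (extChartAt 𝓘(ℝ, E) x x)) :
    DiffForm.d (fun x => L.compContinuousAlternatingMap (θ x) : DiffForm E M G k) x =
      L.compContinuousAlternatingMap (θ.d x) := by
  have h : fderiv ℝ (DiffForm.inChart (fun x => L.compContinuousAlternatingMap (θ x) :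
        DiffForm E M G k) x) (extChartAt 𝓘(ℝ, E) x x) =
      L.compContinuousAlternatingMapCLM ℝ E F G (Fin k) ∘L
        fderiv ℝ (θ.inChart x) (extChartAt 𝓘(ℝ, E) x x) :=
    ((L.compContinuousAlternatingMapCLM ℝ E F G (Fin k)).hasFDerivAt.comp _ hθ.hasFDerivAt).fderiv
  ext v
  change ContinuousAlternatingMap.alternatizeUncurryFin (fderiv ℝ (DiffForm.inChart _ x) _) _ =
    L (ContinuousAlternatingMap.alternatizeUncurryFin (fderiv ℝ (θ.inChart x) _) _)
  rw [h, ContinuousAlternatingMap.alternatizeUncurryFin_apply,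
    ContinuousAlternatingMap.alternatizeUncurryFin_apply, map_sum]
  exact Finset.sum_congr rfl fun i _ => (map_zsmul L _ _).symm

end Charts

/-! ### Smoothness of the soldering form -/

section

variable {d : ℕ} {M : Type*} [TopologicalSpace M] [ChartedSpace (Model d) M]
  [IsManifold 𝓘(ℝ, Model d) ∞ M]
  {EP : Type*} [NormedAddCommGroup EP] [NormedSpace ℝ EP]
  {P : Type*} [TopologicalSpace P] [ChartedSpace EP P]
  {G : Subgroup (Model d ≃L[ℝ] Model d)}

theorem GStructure.contMDiff_π (S : GStructure G EP P M) :
    ContMDiff 𝓘(ℝ, EP) 𝓘(ℝ, Model d) ∞ S.π := fun u =>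
  ((Bundle.contMDiffAt_totalSpace).1 (S.isSmoothEmbedding.contMDiff u)).1

/-- The frame at `u'`, read in the preferred chart of `M` at `π(u)`. -/
def GStructure.frameInChart (S : GStructure G EP P M) (u u' : P) : Model d →L[ℝ] Model d :=
  mfderiv 𝓘(ℝ, Model d) 𝓘(ℝ, Model d) (extChartAt 𝓘(ℝ, Model d) (S.π u)) (S.π u') ∘L
    (S.frame u' : Model d →L[ℝ] TangentSpace 𝓘(ℝ, Model d) (S.π u'))

/-- This is the fibre component of the smooth embedding of `P` in the bundle of linear maps: the
tangent bundle is trivialised by the differential of the chart, and the source bundle is already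
trivial. -/
theorem GStructure.contMDiffAt_frameInChart (S : GStructure G EP P M) (u : P) :
    ContMDiffAt 𝓘(ℝ, EP) 𝓘(ℝ, Model d →L[ℝ] Model d) ∞ (S.frameInChart u) u := by
  have : IsManifold 𝓘(ℝ, Model d) 1 M := .of_le (n := ∞) (by simp)
  have h := (contMDiffAt_hom_bundle _).1 (S.isSmoothEmbedding.contMDiff u)
  refine h.2.congr_of_eventuallyEq ?_
  have hsrc := S.contMDiff_π.continuous.continuousAt.eventually_mem
    (extChartAt_source_mem_nhds (I := 𝓘(ℝ, Model d)) (S.π u))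
  filter_upwards [hsrc] with u' hu'
  rw [extChartAt_source] at hu'
  ext1 v
  simp only [framePoint, ContinuousLinearMap.inCoordinates, GStructure.frameInChart]
  rw [TangentBundle.continuousLinearMapAt_trivializationAt hu']
  simp

theorem GStructure.isInvertible_frameInChart (S : GStructure G EP P M) {u u' : P}
    (hu' : S.π u' ∈ (extChartAt 𝓘(ℝ, Model d) (S.π u)).source) :
    (S.frameInChart u u').IsInvertible := by
  have : IsManifold 𝓘(ℝ, Model d) 1 M := .of_le (n := ∞) (by simp)
  exact (isInvertible_mfderiv_extChartAt (I := 𝓘(ℝ, Model d)) hu').comp ⟨S.frame u', rfl⟩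

/-- Inserting the chart differential and its inverse into `u'⁻¹ ∘ π_*` leaves only operators between
fixed vector spaces, whose smoothness can be checked factor by factor. -/
theorem GStructure.inChart_soldering [IsManifold 𝓘(ℝ, EP) ∞ P] (S : GStructure G EP P M) (u : P) :
    S.soldering.inChart u =ᶠ[𝓝 (extChartAt 𝓘(ℝ, EP) u u)] fun e =>
      ContinuousAlternatingMap.ofSubsingletonLIE (0 : Fin 1)
        ((S.frameInChart u ((extChartAt 𝓘(ℝ, EP) u).symm e)).inverse ∘L
          fderiv ℝ (writtenInExtChartAt 𝓘(ℝ, EP) 𝓘(ℝ, Model d) u S.π) e) := by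
  have : IsManifold 𝓘(ℝ, Model d) 1 M := .of_le (n := ∞) (by simp)
  have : IsManifold 𝓘(ℝ, EP) 1 P := .of_le (n := ∞) (by simp)
  filter_upwards [eventually_mem_charts (E := Model d) (E' := EP) S.contMDiff_π.continuous.continuousAt] with e he
  ext v
  set u' := (extChartAt 𝓘(ℝ, EP) u).symm e with hu'
  have hinv : ∀ w, (S.frameInChart u u').inverse
      (mfderiv 𝓘(ℝ, Model d) 𝓘(ℝ, Model d) (extChartAt 𝓘(ℝ, Model d) (S.π u)) (S.π u') w) =
      (S.frame u').symm w := by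
    intro w
    have h := (S.isInvertible_frameInChart he.2).inverse_apply_self ((S.frame u').symm w)
    have hw : S.frameInChart u u' ((S.frame u').symm w) = mfderiv 𝓘(ℝ, Model d) 𝓘(ℝ, Model d)
        (extChartAt 𝓘(ℝ, Model d) (S.π u)) (S.π u') w :=
      congrArg (mfderiv 𝓘(ℝ, Model d) 𝓘(ℝ, Model d) (extChartAt 𝓘(ℝ, Model d) (S.π u)) (S.π u'))
        ((S.frame u').apply_symm_apply w)
    rwa [hw] at h
  change _ = (S.frameInChart u u').inverse
    (fderiv ℝ (writtenInExtChartAt 𝓘(ℝ, EP) 𝓘(ℝ, Model d) u S.π) e (v 0)) _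
  rw [fderiv_writtenInExtChartAt (S.contMDiff_π.mdifferentiable (by simp) _) he.1 he.2, hinv]
  rfl

/-- Operator inversion is smooth at invertible operators, and the derivative of the coordinate
expression of `π` is smooth. -/
theorem GStructure.contDiffAt_soldering_inChart [IsManifold 𝓘(ℝ, EP) ∞ P]
    (S : GStructure G EP P M) (u : P) :
    ContDiffAt ℝ ∞ (S.soldering.inChart u) (extChartAt 𝓘(ℝ, EP) u u) := by
  refine ContDiffAt.congr_of_eventuallyEq ?_ (S.inChart_soldering u)
  have h1 : ContDiffAt ℝ ∞ (fun e => S.frameInChart u ((extChartAt 𝓘(ℝ, EP) u).symm e))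
      (extChartAt 𝓘(ℝ, EP) u u) := by
    have := (contMDiffAt_iff.1 (S.contMDiffAt_frameInChart u)).2
    rw [modelWithCornersSelf_coe, Set.range_id, contDiffWithinAt_univ] at this
    exact this
  have hinv : (S.frameInChart u ((extChartAt 𝓘(ℝ, EP) u).symm
      (extChartAt 𝓘(ℝ, EP) u u))).IsInvertible :=
    S.isInvertible_frameInChart (by simp)
  have h2 := (hinv.contDiffAt_map_inverse (n := ∞)).comp (extChartAt 𝓘(ℝ, EP) u u) h1
  have h3 : ContDiffAt ℝ ∞ (fderiv ℝ (writtenInExtChartAt 𝓘(ℝ, EP) 𝓘(ℝ, Model d) u S.π))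
      (extChartAt 𝓘(ℝ, EP) u u) :=
    (contDiffAt_writtenInExtChartAt (S.contMDiff_π u)).fderiv_right (by simp)
  exact (ContinuousAlternatingMap.ofSubsingletonLIE (𝕜 := ℝ) (E := EP) (F := Model d)
    (0 : Fin 1)).contDiff.contDiffAt.comp _ (h2.clm_comp h3)

/-! ### The time component of the torsion -/

/-- The coordinate `v ↦ v 0`, i.e. the covector `η` dual to `H`. -/
def timeCovector (d : ℕ) : Model d →L[ℝ] ℝ := EuclideanSpace.proj 0

theorem GStructure.Determines.timeCovector_soldering {S : GStructure (galileanGroup d) EP P M}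
    {𝒢 : GalileanStructure d M} (hS : S.Determines 𝒢) :
    (fun u => (timeCovector d).compContinuousAlternatingMap (S.soldering u) :
      DiffForm EP P ℝ 1) = 𝒢.τ.pullback S.π := by
  funext u
  ext v
  have h := (hS u).1 ((S.frame u).symm (mfderiv 𝓘(ℝ, EP) 𝓘(ℝ, Model d) S.π u (v 0)))
  rw [ContinuousLinearEquiv.apply_symm_apply] at h
  refine h.symm.trans ?_
  change 𝒢.τ (S.π u) _ = 𝒢.τ (S.π u) _
  congr 1
  funext i
  rw [Subsingleton.elim i 0]
  rfl

/-- Matrices in the Galilean Lie algebra have zero first row, so `η` kills each term of the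
alternating sum separately. -/
theorem EhresmannConnection.timeCovector_wedge {S : GStructure (galileanGroup d) EP P M}
    (c : EhresmannConnection S) {k : ℕ} (b : DiffForm EP P (Model d) k) (u : P) :
    (timeCovector d).compContinuousAlternatingMap
      (DiffForm.wedge (ContinuousLinearMap.id ℝ (Model d →L[ℝ] Model d)) c.form b u) = 0 := by
  ext v
  have h : ∀ X w, timeCovector d (c.form.linearAt u X w) = 0 := fun X w => (c.mem u X).1 w
  change timeCovector d (linearWedge (E := EP) _ (c.form.linearAt u) (b u) v) = 0
  refine (congrArg _ (ContinuousAlternatingMap.alternatizeUncurryFin_apply _ _)).trans ?_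
  rw [map_sum]
  refine Finset.sum_eq_zero fun i _ => ?_
  rw [map_zsmul]
  exact (congrArg _ (h _ _)).trans (smul_zero _)

/-- The connection term drops out, so this component of the torsion is the same for all connections:
it is the differential of `η ∘ ϑ = π^*τ`. -/
theorem EhresmannConnection.timeCovector_torsion [IsManifold 𝓘(ℝ, EP) ∞ P]
    {S : GStructure (galileanGroup d) EP P M} (c : EhresmannConnection S)
    {𝒢 : GalileanStructure d M} (hS : S.Determines 𝒢) (u : P) :
    (timeCovector d).compContinuousAlternatingMap (c.torsion u) = 𝒢.τ.d.pullback S.π u := by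
  have h : (timeCovector d).compContinuousAlternatingMap (c.torsion u) =
      (timeCovector d).compContinuousAlternatingMap (S.soldering.d u) +
      (timeCovector d).compContinuousAlternatingMap (DiffForm.wedge
        (ContinuousLinearMap.id ℝ (Model d →L[ℝ] Model d)) c.form S.soldering u) := by
    ext v
    exact map_add (timeCovector d) _ _
  rw [h, c.timeCovector_wedge, add_zero, ← DiffForm.d_compLeft _ _ _
    ((S.contDiffAt_soldering_inChart u).differentiableAt (by simp)), hS.timeCovector_soldering,
    DiffForm.d_pullback 𝒢.τ_smooth S.contMDiff_π]

end

end Galilei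

end

theorem mainTheorem10 {d : ℕ}
    {M : Type*} [TopologicalSpace M] [ChartedSpace (Galilei.Model d) M]
    [IsManifold 𝓘(ℝ, Galilei.Model d) ∞ M]
    {EP : Type*} [NormedAddCommGroup EP] [NormedSpace ℝ EP] [FiniteDimensional ℝ EP]
    {P : Type*} [TopologicalSpace P] [ChartedSpace EP P] [IsManifold 𝓘(ℝ, EP) ∞ P]
    (𝒢 : Galilei.GalileanStructure d M) (h𝒢 : 𝒢.IsIntegrable)
    (S : Galilei.GStructure (Galilei.galileanGroup d) EP P M) (hS : S.Determines 𝒢)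
    (c : Galilei.EhresmannConnection S)
    (α : Galilei.DiffForm (Galilei.Model d) M ℝ 1) (hα_smooth : α.IsSmooth)
    (hα : 𝒢.τ.d = Galilei.DiffForm.wedge (ContinuousLinearMap.mul ℝ ℝ) 𝒢.τ α) (u : P) :
    (Galilei.DiffForm.wedge (ContinuousLinearMap.mul ℝ ℝ) 𝒢.τ α).pullback S.π u =
      (𝒢.τ.linearAt (S.π u)).compContinuousAlternatingMap (S.applyFrame c.torsion u) := by
  rw [← hα, ← c.timeCovector_torsion hS]
  ext v
  -- What is left is `τ ∘ u = η` on the vector `Θ_u(v)`.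
  exact ((hS u).1 (c.torsion u v)).symm
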